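/- Let $\mathbb D$ be the open unit disc in $\mathbb C$, and let $\mathbb G_3=\{(z_1+z_2+z_3,\;z_1z_2+z_2z_3+z_3z_1,\;z_1z_2z_3): z_1,z_2,z_3\in\mathbb D\}\subset\mathbb C^3$ be the symmetrized tridisc; let $e_2=(0,1,0)$. Write $\mathcal O(A,B)$ for the holomorphic maps from $A$ to $B$. For a domain $D\subset\mathbb C^n$, $z,w\in D$, $X\in\mathbb C^n$ and an integer $k\ge1$ put $$\gamma_D(z;X)=\sup\{|f'(z)X|: f\in\mathcal O(D,\mathbb D),\ f(z)=0\},$$ $$\gamma_D^{(k)}(z;X)=\sup\Big\{\Big|\sum_{|\alpha|=k}\tfrac{D^\alpha f(z)X^\alpha}{\alpha!}\Big|^{1/k}: f\in\mathcal O(D,\mathbb D),\ \operatorname{ord}_z f\ge k\Big\},$$ $$\kappa_D(z;X)=\inf\{|\alpha|:\alpha\in\mathbb C,\ \exists\,\varphi\in\mathcal O(\mathbb D,D),\ \varphi(0)=z,\ \alpha\varphi'(0)=X\}$$ (the Carathéodory metric, the Carathéodory metric of order $k$, and the Kobayashi metric), and let $\hat\gamma_D^{(k)}(z;\cdot)$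 and $\hat\kappa_D(z;\cdot)$ be the largest complex seminorms on $\mathbb C^n$ not exceeding $\gamma_D^{(k)}(z;\cdot)$ and $\kappa_D(z;\cdot)$, respectively. Let $$c_D(z,w)=\sup\Big\{\tanh^{-1}\Big|\frac{f(z)-f(w)}{1-\overline{f(z)}f(w)}\Big|: f\in\mathcal O(D,\mathbb D)\Big\}$$ be the Carathéodory distance, and let the Kobayashi distance $k_D(z,w)$ be the infimum of $\sum_{j=1}^m\tanh^{-1}|\alpha_j|$ over all finite chains $z=p_0,p_1,\dots,p_m=w$ in $D$ and $\alpha_j\in\mathbb D$ for which there are $\varphi_j\in\mathcal O(\mathbb D,D)$ with $\varphi_j(0)=p_{j-1}$ and $\varphi_j(\alpha_j)=p_j$. Theorem. $\hat\gamma^{(2)}_{\mathbb G_3}(0;e_2)>\gamma_{\mathbb G_3}(0;e_2)$. In particular, $\hat\kappa_{\mathbb G_3}(0;e_2)>\gamma_{\mathbb G_3}(0;e_2)$, and consequently $k_{\mathbb G_3}(0,\cdot)\ne c_{\mathbb G_3}(0,\cdot)$, i.e. there is $z\in\mathbb G_3$ with $k_{\mathbb G_3}(0,z)\neq c_{\mathbb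 G_3}(0,z)$. -/

import Mathlib

open scoped ComplexConjugate

noncomputable section

/-- The open unit disc in the complex plane. -/
def unitDisc : Set ℂ := Metric.ball 0 1

/-- `HolMap A B f`: the function `f` is a holomorphic map from the (open) set `A` to the set `B`. -/
def HolMap {E F : Type*} [NormedAddCommGroup E] [NormedSpace ℂ E]
    [NormedAddCommGroup F] [NormedSpace ℂ F] (A : Set E) (B : Set F) (f : E → F) : Prop :=
  DifferentiableOn ℂ f A ∧ Set.MapsTo f A B

/-- The symmetrization map `σ = (σ₁, …, σₙ)`: its components are the elementary symmetric
polynomials (the coordinate with index `k : Fin n` is the polynomial of degree `k + 1`). -/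
def symmetrization (n : ℕ) (z : Fin n → ℂ) : Fin n → ℂ :=
  fun k => ∑ s ∈ Finset.powersetCard (k.val + 1) (Finset.univ : Finset (Fin n)), ∏ j ∈ s, z j

/-- The symmetrized `n`-disc: the image of the polydisc under the symmetrization map. -/
def symmetrizedDisc (n : ℕ) : Set (Fin n → ℂ) :=
  symmetrization n '' {z | ∀ j, z j ∈ unitDisc}

section Metrics

variable {E : Type*} [NormedAddCommGroup E] [NormedSpace ℂ E]

/-- The Carathéodory(–Reiffen) pseudometric of an open set `D` at `z` in the direction `X`:
the supremum of `|f'(z)X|` over holomorphic `f : D → 𝔻` with `f z = 0`. -/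
def caratheodoryMetric (D : Set E) (z X : E) : ℝ :=
  sSup {r | ∃ f : E → ℂ, HolMap D unitDisc f ∧ f z = 0 ∧ r = ‖fderiv ℂ f z X‖}

/-- The degree `k` homogeneous Taylor polynomial of `f` at `z`, evaluated at `X`;
in coordinates this is `∑_{|α| = k} D^α f(z) X^α / α!`. -/
def taylorForm (k : ℕ) (f : E → ℂ) (z X : E) : ℂ :=
  (k.factorial : ℂ)⁻¹ * iteratedFDeriv ℂ k f z (fun _ => X)

/-- The `k`-th order Carathéodory pseudometric (`k ≥ 1`): the supremum of the `k`-th roots of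
the absolute values of the `k`-th Taylor form at `z`, over all holomorphic `f : D → 𝔻` which
vanish at `z` to order at least `k`. -/
def caratheodoryMetricOrder (k : ℕ) (D : Set E) (z X : E) : ℝ :=
  sSup {r | ∃ f : E → ℂ, HolMap D unitDisc f ∧
    (∀ j < k, iteratedFDeriv ℂ j f z = 0) ∧ r = ‖taylorForm k f z X‖ ^ (1 / (k : ℝ))}

/-- The Kobayashi(–Royden) pseudometric. -/
def kobayashiMetric (D : Set E) (z X : E) : ℝ :=
  sInf {r | ∃ φ : ℂ → E, HolMap unitDisc D φ ∧ φ 0 = z ∧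
    ∃ α : ℂ, α • deriv φ 0 = X ∧ r = ‖α‖}

/-- The largest complex seminorm not exceeding the nonnegative function `F`. -/
def seminormHull (F : E → ℝ) : Seminorm ℂ E :=
  sSup {p : Seminorm ℂ E | ∀ Y, p Y ≤ F Y}

/-- For nonnegative `F` the hull really is the largest seminorm below `F`. -/
theorem seminormHull_isGreatest {F : E → ℝ} (hF : ∀ Y, 0 ≤ F Y) :
    IsGreatest {p : Seminorm ℂ E | ∀ Y, p Y ≤ F Y} (seminormHull F) := by
  have hb : BddAbove {p : Seminorm ℂ E | ∀ Y, p Y ≤ F Y} := by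
    rw [Seminorm.bddAbove_iff]
    refine ⟨F, ?_⟩
    rintro _ ⟨p, hp, rfl⟩
    exact hp
  have hne : Nonempty {p : Seminorm ℂ E | ∀ Y, p Y ≤ F Y} := ⟨⟨0, fun Y => by simpa using hF Y⟩⟩
  refine ⟨fun Y => ?_, fun p hp => le_csSup hb hp⟩
  rw [seminormHull, Seminorm.sSup_apply hb]
  exact ciSup_le fun p => p.2 Y

/-- The Poincaré distance `tanh⁻¹ |(a - b) / (1 - ā b)|` of the unit disc. -/
def poincareDist (a b : ℂ) : ℝ :=
  Real.artanh ‖(a - b) / (1 - conj a * b)‖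

/-- The Carathéodory pseudodistance of a domain `D`. -/
def caratheodoryDist (D : Set E) (z w : E) : ℝ :=
  sSup {r | ∃ f : E → ℂ, HolMap D unitDisc f ∧ r = poincareDist (f z) (f w)}

/-- The radii `|α|`, `α ∈ 𝔻`, for which some holomorphic `φ : 𝔻 → D` maps `0` to `z` and `α`
to `w`; their infimum is the Lempert function of `D` at `(z, w)`. -/
def discRadii (D : Set E) (z w : E) : Set ℝ :=
  {r | ∃ φ : ℂ → E, HolMap unitDisc D φ ∧ φ 0 = z ∧
    ∃ α ∈ unitDisc, φ α = w ∧ r = ‖α‖}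

/-- The Kobayashi pseudodistance of a domain `D`: the infimum of the lengths of chains of analytic
discs in `D` which join `z` to `w`. -/
def kobayashiDist (D : Set E) (z w : E) : ℝ :=
  sInf {s | ∃ (m : ℕ) (p : ℕ → E) (r : ℕ → ℝ), p 0 = z ∧ p m = w ∧
    (∀ j < m, r j ∈ discRadii D (p j) (p (j + 1))) ∧
    s = ∑ j ∈ Finset.range m, Real.artanh (r j)}

end Metrics

/-- The second vector of the standard basis of `ℂ³`. -/
def e₂ : Fin 3 → ℂ := Pi.single 1 1

end

/-! Write s = (s₀, s₁, s₂) for the coordinates. The theorem rests on a narrow numerical gap in the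
direction `e₂`: 400/487 ≈ 0.82136 bounds the Carathéodory metric from above, 1027/1250 = 0.8216
bounds the two hulls from below.

Upper bound. The discs l ↦ (la, l²b, l³c) through points of 𝔾₃ stay in 𝔾₃. Along two of them with
the same a, the terms of f in s₀ and s₀² agree, so the difference of f starts with l²(b -
b')∂f/∂s₁(0), and the Schwarz lemma bounds that coefficient by 2 (`norm_fderiv_mul_norm_sub_le`).
Pairing a point with a reflected one makes b - b' large.

Lower bound. P = s₁² - 0.431 s₀²s₁ + 0.0484 s₀⁴ (`quarticForm`) has order two at 0 with second
Taylor form X₁². The terms in s₀ do not affect that form, but they bring the supremum on 𝔾₃ from 9,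
for s₁² alone, down to at most 1.48 (`norm_quarticForm_le`). A multiple of P therefore gives γ⁽²⁾(0;
X) ≥ 0.8216 |X₁| for all X, and the right side is a seminorm. If φ is a disc with φ(0) = 0, then
(P∘φ)''(0)/2 = φ₁'(0)², so κ has the same minorant.

Distances. The estimate on discs survives, with a small loss, when φ(0) is merely near 0
(`sq_norm_deriv_quadraticForm_le`). The increments of `quadraticForm` can then be summed along a
chain of discs, and the gap persists at t • `e₂` for small t > 0. -/

theorem symmetrization_three (z : Fin 3 → ℂ) :
    symmetrization 3 z = ![z 0 + z 1 + z 2, z 0 * z 1 + z 0 * z 2 + z 1 * z 2, z 0 * z 1 * z 2] := by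
  have h1 : Finset.powersetCard 1 (Finset.univ : Finset (Fin 3)) = {{0}, {1}, {2}} := by decide
  have h2 : Finset.powersetCard 2 (Finset.univ : Finset (Fin 3)) = {{0, 1}, {0, 2}, {1, 2}} := by
    decide
  have h3 : Finset.powersetCard 3 (Finset.univ : Finset (Fin 3)) = {{0, 1, 2}} := by decide
  funext k
  fin_cases k
  · simp only [symmetrization]
    change ∑ s ∈ Finset.powersetCard 1 (Finset.univ : Finset (Fin 3)), _ = _
    rw [h1, Finset.sum_insert (by decide), Finset.sum_insert (by decide), Finset.sum_singleton]
    simp [add_assoc]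
  · simp only [symmetrization]
    change ∑ s ∈ Finset.powersetCard 2 (Finset.univ : Finset (Fin 3)), _ = _
    rw [h2, Finset.sum_insert (by decide), Finset.sum_insert (by decide), Finset.sum_singleton]
    simp [add_assoc]
  · simp only [symmetrization]
    change ∑ s ∈ Finset.powersetCard 3 (Finset.univ : Finset (Fin 3)), _ = _
    rw [h3, Finset.sum_singleton]
    simp [mul_assoc]

theorem mem_symmetrizedDisc_three {s : Fin 3 → ℂ} :
    s ∈ symmetrizedDisc 3 ↔ ∃ x y z : ℂ, ‖x‖ < 1 ∧ ‖y‖ < 1 ∧ ‖z‖ < 1 ∧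
      s = ![x + y + z, x * y + x * z + y * z, x * y * z] := by
  constructor
  · rintro ⟨z, hz, rfl⟩
    have h : ∀ j, ‖z j‖ < 1 := fun j => by simpa [unitDisc] using hz j
    exact ⟨z 0, z 1, z 2, h 0, h 1, h 2, symmetrization_three z⟩
  · rintro ⟨x, y, z, hx, hy, hz, rfl⟩
    refine ⟨![x, y, z], fun j => ?_, by simp [symmetrization_three]⟩
    fin_cases j <;> simpa [unitDisc]

/-! ### The supremum of the quartic on the symmetrized tridisc -/

/-- The weighted homogeneous polynomial of weight four which bounds the second order metric. -/
noncomputable def quarticForm (s : Fin 3 → ℂ) : ℂ :=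
  s 1 ^ 2 - (431 / 1000) * s 0 ^ 2 * s 1 + (121 / 2500) * s 0 ^ 4

theorem quadratic_le_of_endpoints {A B C y₀ y₁ y M : ℝ} (hA : 0 ≤ A) (h₀ : y₀ ≤ y) (h₁ : y ≤ y₁)
    (hM₀ : A * y₀ ^ 2 + B * y₀ + C ≤ M) (hM₁ : A * y₁ ^ 2 + B * y₁ + C ≤ M) :
    A * y ^ 2 + B * y + C ≤ M := by
  rcases (h₀.trans h₁).eq_or_lt with h | h
  · obtain rfl : y = y₀ := le_antisymm (h₁.trans h.ge) h₀
    exact hM₀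
  · have e : (y₁ - y₀) * (M - (A * y ^ 2 + B * y + C)) =
        (y₁ - y) * (M - (A * y₀ ^ 2 + B * y₀ + C)) + (y - y₀) * (M - (A * y₁ ^ 2 + B * y₁ + C))
        + A * ((y₁ - y₀) * ((y - y₀) * (y₁ - y))) := by ring
    have h2 : 0 ≤ (y₁ - y₀) * (M - (A * y ^ 2 + B * y + C)) := by
      rw [e]
      have := sub_nonneg.2 h₀
      have := sub_nonneg.2 h₁
      have := sub_nonneg.2 hM₀
      have := sub_nonneg.2 hM₁
      have := sub_nonneg.2 h.le
      positivity
    have := nonneg_of_mul_nonneg_right h2 (sub_pos.2 h)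
    linarith

/-- The left side is |P|² on the torus with u = |s₀|² and y = Re(s₀³ conj s₂). It is convex in y, so
only the ends of the range of y matter: y = ±u^(3/2) for u ≤ 1, and for u ≥ 1 the discriminant curve
replaces the lower end. -/
theorem deltoid_bound {u y : ℝ} (hu : 0 ≤ u) (hu9 : u ≤ 9) (hy : y ^ 2 ≤ u ^ 3)
    (hd : u ^ 2 + 18 * u - 27 ≤ 8 * y) :
    121 / 625 * y ^ 2 + (- (431 / 500) * u * (1 + 121 / 2500 * u)) * y +
      u ^ 2 * (1 + (431 / 1000) ^ 2 * u + (121 / 2500) ^ 2 * u ^ 2 - 121 / 1250 * u)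
      ≤ (37 / 25) ^ 2 := by
  obtain ⟨r, hr, rfl⟩ : ∃ r : ℝ, 0 ≤ r ∧ u = r ^ 2 := ⟨√u, by positivity, by rw [Real.sq_sqrt hu]⟩
  have hr3 : r ≤ 3 := by nlinarith
  have hy' : |y| ≤ r ^ 3 := abs_le_of_sq_le_sq (by nlinarith) (by positivity)
  obtain ⟨hy1, hy2⟩ := abs_le.1 hy'
  have top : 121 / 625 * (r ^ 3) ^ 2 + (- (431 / 500) * r ^ 2 * (1 + 121 / 2500 * r ^ 2)) * r ^ 3 +
      (r ^ 2) ^ 2 * (1 + (431 / 1000) ^ 2 * r ^ 2 + (121 / 2500) ^ 2 * (r ^ 2) ^ 2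
        - 121 / 1250 * r ^ 2) ≤ (37 / 25) ^ 2 := by
    have e : 121 / 625 * (r ^ 3) ^ 2 + (- (431 / 500) * r ^ 2 * (1 + 121 / 2500 * r ^ 2)) * r ^ 3 +
      (r ^ 2) ^ 2 * (1 + (431 / 1000) ^ 2 * r ^ 2 + (121 / 2500) ^ 2 * (r ^ 2) ^ 2
        - 121 / 1250 * r ^ 2) = (r ^ 2 * (1 - 431 / 1000 * r + 121 / 2500 * r ^ 2)) ^ 2 := by ring
    rw [e]
    have h1 : 0 ≤ 1 - 431 / 1000 * r + 121 / 2500 * r ^ 2 := by nlinarith [sq_nonneg (r - 9/2)]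
    have h2 : r ^ 2 * (1 - 431 / 1000 * r + 121 / 2500 * r ^ 2) ≤ 37 / 25 := by
      nlinarith [mul_nonneg hr (sub_nonneg.2 hr3), mul_nonneg (mul_nonneg hr (sub_nonneg.2 hr3)) (sq_nonneg (r - 12/5)), mul_nonneg (sub_nonneg.2 hr3) (sq_nonneg (r - 12/5)), mul_nonneg hr (sq_nonneg (r - 12/5)), sq_nonneg (r-12/5)]
    exact pow_le_pow_left₀ (by positivity) h2 2
  rcases le_total r 1 with h | h
  · refine quadratic_le_of_endpoints (by norm_num) hy1 hy2 ?_ top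
    have e : 121 / 625 * (-r ^ 3) ^ 2 + (- (431 / 500) * r ^ 2 * (1 + 121 / 2500 * r ^ 2)) * -r ^ 3 +
      (r ^ 2) ^ 2 * (1 + (431 / 1000) ^ 2 * r ^ 2 + (121 / 2500) ^ 2 * (r ^ 2) ^ 2
        - 121 / 1250 * r ^ 2) = (r ^ 2 * (1 + 431 / 1000 * r + 121 / 2500 * r ^ 2)) ^ 2 := by ring
    rw [e]
    have h2 : r ^ 2 ≤ 1 := by nlinarith
    refine pow_le_pow_left₀ (by positivity) ?_ 2
    -- The value at r = 1 is 1.4794: one of the two places where 1.48 is almost attained.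
    calc _ ≤ (1 : ℝ) * (1 + 431 / 1000 * 1 + 121 / 2500 * 1) := by gcongr
      _ ≤ _ := by norm_num
  · have hu1 : 1 ≤ r ^ 2 := by nlinarith
    refine quadratic_le_of_endpoints (y₀ := ((r ^ 2) ^ 2 + 18 * r ^ 2 - 27) / 8) (by norm_num)
      (by linarith) hy2 ?_ top
    generalize r ^ 2 = u at *
    have h1 := sub_nonneg.2 hu1
    have h9 := sub_nonneg.2 hu9
    -- The bound is nearly attained again close to u = 11/5, hence the squares vanishing there.
    nlinarith [mul_nonneg (mul_nonneg h1 h9) (sq_nonneg (u - 11/5)), mul_nonneg h1 (sq_nonneg (u - 11/5)), sq_nonneg (u - 11/5), mul_nonneg h1 h9]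

theorem conj_eq_inv_of_norm_one {z : ℂ} (h : ‖z‖ = 1) : conj z = z⁻¹ := by
  rw [Complex.inv_def, Complex.normSq_eq_norm_sq, h]; simp

/-- On the torus s₁ = s₂ conj s₀, so |P| depends only on u = |s₀|² and w = s₀³ conj s₂, where |w|² =
u³. The squared modulus of the Vandermonde product is 27 - 18u + 8 Re w - u², and its nonnegativity
is the remaining constraint. -/
theorem quarticForm_le_of_torus {x y z : ℂ} (hx : ‖x‖ = 1) (hy : ‖y‖ = 1) (hz : ‖z‖ = 1) :
    ‖quarticForm ![x + y + z, x * y + x * z + y * z, x * y * z]‖ ≤ 37 / 25 := by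
  have x0 : x ≠ 0 := fun h => by simp [h] at hx
  have y0 : y ≠ 0 := fun h => by simp [h] at hy
  have z0 : z ≠ 0 := fun h => by simp [h] at hz
  have cx := conj_eq_inv_of_norm_one hx
  have cy := conj_eq_inv_of_norm_one hy
  have cz := conj_eq_inv_of_norm_one hz
  set s := x + y + z with hs
  set t := x * y * z with ht
  have ht1 : ‖t‖ = 1 := by simp [ht, hx, hy, hz]
  have htt : t * conj t = 1 := by rw [Complex.mul_conj, Complex.normSq_eq_norm_sq, ht1]; simp
  have he : x * y + x * z + y * z = t * conj s := by
    rw [hs, ht]; simp only [map_add, cx, cy, cz]; field_simp; ring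
  set u : ℝ := Complex.normSq s with hu
  have huc : (u : ℂ) = s * conj s := (Complex.mul_conj s).symm
  set w : ℂ := s ^ 3 * conj t with hw
  have hwn : Complex.normSq w = u ^ 3 := by
    rw [hw, map_mul, map_pow, Complex.normSq_conj, Complex.normSq_eq_norm_sq t, ht1]; simp [hu]
  have hw2 : w.re ^ 2 + w.im ^ 2 = u ^ 3 := by rw [← hwn, Complex.normSq_apply]; ring
  have hdisc : u ^ 2 + 18 * u - 27 ≤ 8 * w.re := by
    have key : ((27 - 18 * u + 8 * w.re - u ^ 2 : ℝ) : ℂ) =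
        Complex.normSq ((x - y) * (y - z) * (z - x)) := by
      rw [← Complex.mul_conj]
      have hre : (8 * w.re : ℂ) = 4 * (w + conj w) := by rw [Complex.add_conj]; push_cast; ring
      push_cast
      rw [hre, huc, hw, hs, ht]
      simp only [map_add, map_mul, map_sub, map_pow, map_inv₀, inv_inv, cx, cy, cz]
      field_simp
      ring
    have := Complex.normSq_nonneg ((x - y) * (y - z) * (z - x))
    rw [← Complex.ofReal_inj.1 key] at this
    linarith
  have hs3 : ‖s‖ ≤ 3 := by
    calc ‖s‖ ≤ ‖x‖ + ‖y‖ + ‖z‖ := norm_add₃_le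
      _ = 3 := by rw [hx, hy, hz]; norm_num
  have hu9 : u ≤ 9 := by
    rw [hu, Complex.normSq_eq_norm_sq]; nlinarith [norm_nonneg s]
  have hu0 : 0 ≤ u := Complex.normSq_nonneg _
  have hG := deltoid_bound hu0 hu9 (by nlinarith [sq_nonneg w.im]) hdisc
  rw [he]
  set P := quarticForm ![s, t * conj s, t] with hP
  have hPe : P = (t * conj s) ^ 2 - (431 / 1000) * s ^ 2 * (t * conj s) + (121 / 2500) * s ^ 4 := by
    simp [hP, quarticForm]
  rcases eq_or_ne s 0 with h0 | h0
  · rw [hPe, h0]; norm_num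
  have hupos : 0 < u := Complex.normSq_pos.2 h0
  -- The factor has modulus u, and the product is a polynomial in u and w alone.
  have h1 : s ^ 2 * conj t ^ 2 * P =
      (u : ℂ) ^ 2 - (431 / 1000) * u * w + (121 / 2500) * w ^ 2 := by
    rw [hPe, huc, hw]
    linear_combination (s ^ 2 * conj s ^ 2 * (t * conj t + 1) -
      431 / 1000 * s ^ 4 * conj t * conj s) * htt
  have h2 := congrArg Complex.normSq h1
  have h3 : u ^ 2 * Complex.normSq P = u ^ 2 * (121 / 625 * w.re ^ 2 +
      (- (431 / 500) * u * (1 + 121 / 2500 * u)) * w.re +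
      u ^ 2 * (1 + (431 / 1000) ^ 2 * u + (121 / 2500) ^ 2 * u ^ 2 - 121 / 1250 * u)) := by
    have : Complex.normSq (s ^ 2 * conj t ^ 2 * P) = u ^ 2 * Complex.normSq P := by
      rw [map_mul, map_mul, map_pow, map_pow, Complex.normSq_conj, Complex.normSq_eq_norm_sq t, ht1]
      simp [hu]
    rw [← this, h2]
    have e : (u : ℂ) ^ 2 - (431 / 1000) * u * w + (121 / 2500) * w ^ 2 =
      ((u ^ 2 - 431 / 1000 * u * w.re + 121 / 2500 * (w.re ^ 2 - w.im ^ 2) : ℝ) : ℂ) +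
      ((- 431 / 1000 * u * w.im + 121 / 1250 * w.re * w.im : ℝ) : ℂ) * Complex.I := by
      conv_lhs => rw [← Complex.re_add_im w]
      push_cast
      linear_combination (121 / 2500 * (w.im : ℂ) ^ 2) * Complex.I_sq
    rw [e, Complex.normSq_add_mul_I]
    have him : w.im ^ 2 = u ^ 3 - w.re ^ 2 := by linarith
    linear_combination ((431 / 1000) ^ 2 * u ^ 2 + (121 / 2500) ^ 2 * (2 * w.re ^ 2 + w.im ^ 2 + u ^ 3 - w.re ^ 2) - 2 * 121 / 2500 * u ^ 2 - 2 * 121 / 2500 * 431 / 1000 * u * w.re) * him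
  have h4 := mul_left_cancel₀ (by positivity) h3
  rw [← h4, Complex.normSq_eq_norm_sq] at hG
  exact le_of_sq_le_sq hG (by norm_num)

theorem norm_le_of_forall_norm_one {f : ℂ → ℂ} (hf : Differentiable ℂ f) {C : ℝ}
    (h : ∀ z, ‖z‖ = 1 → ‖f z‖ ≤ C) {z : ℂ} (hz : ‖z‖ ≤ 1) : ‖f z‖ ≤ C := by
  refine Complex.norm_le_of_forall_mem_frontier_norm_le (U := Metric.ball 0 1)
    Metric.isBounded_ball hf.diffContOnCl (fun w hw => h w ?_) ?_
  · rw [frontier_ball _ one_ne_zero] at hw; simpa using hw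
  · rw [closure_ball _ one_ne_zero]; simpa using hz

theorem norm_quarticForm_le {s : Fin 3 → ℂ} (hs : s ∈ symmetrizedDisc 3) :
    ‖quarticForm s‖ ≤ 37 / 25 := by
  obtain ⟨x, y, z, hx, hy, hz, rfl⟩ := mem_symmetrizedDisc_three.1 hs
  have e : ∀ x y z : ℂ, quarticForm ![x + y + z, x * y + x * z + y * z, x * y * z] =
      (x * y + x * z + y * z) ^ 2 - (431 / 1000) * (x + y + z) ^ 2 * (x * y + x * z + y * z) +
      (121 / 2500) * (x + y + z) ^ 4 := fun x y z => by simp [quarticForm]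
  refine norm_le_of_forall_norm_one
    (f := fun x => quarticForm ![x + y + z, x * y + x * z + y * z, x * y * z])
    (by simp only [e]; fun_prop) (fun x hx => ?_) hx.le
  refine norm_le_of_forall_norm_one
    (f := fun y => quarticForm ![x + y + z, x * y + x * z + y * z, x * y * z])
    (by simp only [e]; fun_prop) (fun y hy => ?_) hy.le
  exact norm_le_of_forall_norm_one
    (f := fun z => quarticForm ![x + y + z, x * y + x * z + y * z, x * y * z])
    (by simp only [e]; fun_prop) (fun z hz => quarticForm_le_of_torus hx hy hz) hz.le

/-! ### Boundedness, weighted dilations and a ball around the origin -/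

theorem norm_le_of_mem_symmetrizedDisc {s : Fin 3 → ℂ} (hs : s ∈ symmetrizedDisc 3) : ‖s‖ ≤ 3 := by
  obtain ⟨x, y, z, hx, hy, hz, rfl⟩ := mem_symmetrizedDisc_three.1 hs
  have hxy : ‖x * y‖ ≤ 1 := by
    rw [norm_mul]; exact mul_le_one₀ hx.le (norm_nonneg _) hy.le
  have hxz : ‖x * z‖ ≤ 1 := by
    rw [norm_mul]; exact mul_le_one₀ hx.le (norm_nonneg _) hz.le
  have hyz : ‖y * z‖ ≤ 1 := by
    rw [norm_mul]; exact mul_le_one₀ hy.le (norm_nonneg _) hz.le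
  refine (pi_norm_le_iff_of_nonneg (by norm_num)).2 fun i => ?_
  fin_cases i
  · exact norm_add₃_le.trans (by linarith)
  · exact norm_add₃_le.trans (by linarith)
  · change ‖x * y * z‖ ≤ 3
    rw [norm_mul]
    nlinarith [norm_nonneg z, norm_nonneg (x * y)]

theorem weighted_smul_mem {s : Fin 3 → ℂ} (hs : s ∈ symmetrizedDisc 3) {c : ℂ} (hc : ‖c‖ ≤ 1) :
    ![c * s 0, c ^ 2 * s 1, c ^ 3 * s 2] ∈ symmetrizedDisc 3 := by
  obtain ⟨x, y, z, hx, hy, hz, rfl⟩ := mem_symmetrizedDisc_three.1 hs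
  have h : ∀ w : ℂ, ‖w‖ < 1 → ‖c * w‖ < 1 := fun w hw => by
    rw [norm_mul]; nlinarith [norm_nonneg w, norm_nonneg c]
  refine mem_symmetrizedDisc_three.2 ⟨c * x, c * y, c * z, h x hx, h y hy, h z hz, ?_⟩
  ext i
  fin_cases i <;> simp <;> ring

theorem cubic_factorization (a b c : ℂ) :
    ∃ x y z : ℂ, a = x + y + z ∧ b = x * y + x * z + y * z ∧ c = x * y * z := by
  obtain ⟨x, hx⟩ := IsAlgClosed.exists_root
    (Polynomial.C 1 * Polynomial.X ^ 3 + Polynomial.C (-a) * Polynomial.X ^ 2 +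
      Polynomial.C b * Polynomial.X + Polynomial.C (-c))
    (by rw [Polynomial.degree_cubic one_ne_zero]; norm_num)
  simp only [Polynomial.IsRoot.def, Polynomial.eval_add, Polynomial.eval_mul, Polynomial.eval_C,
    Polynomial.eval_pow, Polynomial.eval_X] at hx
  obtain ⟨d, hd⟩ := IsAlgClosed.exists_pow_nat_eq
    ((a - x) ^ 2 - 4 * (b - x * (a - x))) (n := 2) (by norm_num)
  refine ⟨x, (a - x + d) / 2, (a - x - d) / 2, by ring, ?_, ?_⟩
  · linear_combination (1 / 4) * hd
  · linear_combination (-1 : ℂ) * hx + x / 4 * hd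

theorem ball_subset_symmetrizedDisc : Metric.ball 0 (1 / 4) ⊆ symmetrizedDisc 3 := by
  intro s hs
  have hs' : ∀ i, ‖s i‖ < 1 / 4 := fun i => (norm_le_pi_norm s i).trans_lt (by simpa using hs)
  obtain ⟨x, y, z, h0, h1, h2⟩ := cubic_factorization (s 0) (s 1) (s 2)
  -- A root with |w| ≥ 1 would satisfy |w|³ ≤ (|w|² + |w| + 1)/4 ≤ (3/4)|w|³.
  have key : ∀ w : ℂ, w ^ 3 = s 0 * w ^ 2 - s 1 * w + s 2 → ‖w‖ < 1 := by
    intro w hw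
    by_contra! hge
    have h3 : ‖w‖ ^ 3 ≤ 1 / 4 * ‖w‖ ^ 2 + 1 / 4 * ‖w‖ + 1 / 4 := by
      rw [← norm_pow, hw]
      refine (norm_add_le _ _).trans (add_le_add ((norm_sub_le _ _).trans (add_le_add ?_ ?_))
        (hs' 2).le)
      · rw [norm_mul, norm_pow]; gcongr; exact (hs' 0).le
      · rw [norm_mul]; gcongr; exact (hs' 1).le
    nlinarith [mul_nonneg (sub_nonneg.2 hge) (norm_nonneg w), mul_nonneg (mul_nonneg (sub_nonneg.2 hge) (norm_nonneg w)) (norm_nonneg w)]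
  refine mem_symmetrizedDisc_three.2 ⟨x, y, z, key x ?_, key y ?_, key z ?_, ?_⟩
  · rw [h0, h1, h2]; ring
  · rw [h0, h1, h2]; ring
  · rw [h0, h1, h2]; ring
  · ext i; fin_cases i <;> simp [h0, h1, h2]

/-! ### The upper bound for the Carathéodory metric -/

open Metric Filter Topology Asymptotics in
-- By the Schwarz lemma w ↦ f(x + w) - f(w) is O(‖x‖) on a ball; a second use bounds its derivative
-- at 0, so `fderiv ℂ f` is continuous there. Strictness matters later: two arguments of size |l|
-- that differ by O(l²) must give an error o(l²), where plain differentiability gives only o(l).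
theorem hasStrictFDerivAt_of_differentiableOn_ball {E : Type*} [NormedAddCommGroup E]
    [NormedSpace ℂ E] {f : E → ℂ} {R C : ℝ} (hR : 0 < R) (hf : DifferentiableOn ℂ f (ball 0 R))
    (hC : ∀ x ∈ ball (0 : E) R, ‖f x‖ ≤ C) : HasStrictFDerivAt f (fderiv ℂ f 0) 0 := by
  have hat : ∀ x ∈ ball (0 : E) R, DifferentiableAt ℂ f x := fun x hx =>
    hf.differentiableAt (isOpen_ball.mem_nhds hx)
  refine hasStrictFDerivAt_of_hasFDerivAt_of_continuousAt
    (f' := fderiv ℂ f) (eventually_of_mem (ball_mem_nhds 0 hR) fun x hx => (hat x hx).hasFDerivAt) ?_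
  have hlip : ∀ w ∈ ball (0 : E) (R / 2), ∀ x ∈ ball (0 : E) (R / 2),
      ‖f (x + w) - f w‖ ≤ 2 * C / (R / 2) * ‖x‖ := by
    intro w hw x hx
    have hsub : ball w (R / 2) ⊆ ball 0 R := ball_subset_ball' (by
      rw [mem_ball] at hw; linarith)
    have := Complex.dist_le_div_mul_dist_of_mapsTo_ball (f := f) (c := w) (R₁ := R / 2)
      (R₂ := 2 * C) (z := x + w) (hf.mono hsub) (fun y hy => ?_) (by simpa using hx)
    · simpa [dist_eq_norm] using this
    · rw [mem_closedBall, dist_eq_norm]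
      calc _ ≤ ‖f y‖ + ‖f w‖ := norm_sub_le _ _
        _ ≤ C + C := add_le_add (hC _ (hsub hy)) (hC _ (hsub (mem_ball_self (by linarith))))
        _ = _ := by ring
  have hbound : ∀ᶠ x in 𝓝 (0 : E),
      ‖fderiv ℂ f x - fderiv ℂ f 0‖ ≤ 2 * (2 * C / (R / 2) * ‖x‖) / (R / 2) := by
    refine eventually_of_mem (ball_mem_nhds 0 (half_pos hR)) fun x hx => ?_
    have hmem : ∀ w ∈ ball (0 : E) (R / 2), x + w ∈ ball (0 : E) R := fun w hw => by
      rw [mem_ball_zero_iff] at *; exact (norm_add_le _ _).trans_lt (by linarith)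
    have hd : fderiv ℂ (fun w => f (x + w) - f w) 0 = fderiv ℂ f x - fderiv ℂ f 0 := by
      rw [fderiv_fun_sub, fderiv_comp_add_left, add_zero]
      · exact (differentiableAt_comp_add_left _).2
          (hat _ (hmem 0 (mem_ball_self (half_pos hR))))
      · exact hat 0 (mem_ball_self hR)
    rw [← hd]
    refine Complex.norm_fderiv_le_div_of_mapsTo_ball (R₁ := R / 2) (fun w hw => ?_)
      (fun w hw => ?_) (half_pos hR)
    · refine DifferentiableAt.differentiableWithinAt (DifferentiableAt.sub ?_ ?_)
      · exact (differentiableAt_comp_add_left _).2 (hat _ (hmem w hw))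
      · exact hat w (ball_subset_ball (by linarith) hw)
    · rw [mem_closedBall, dist_eq_norm]
      refine (norm_sub_le _ _).trans ?_
      rw [two_mul]
      exact add_le_add (hlip w hw x hx) (hlip 0 (mem_ball_self (half_pos hR)) x hx)
  rw [ContinuousAt, tendsto_iff_norm_sub_tendsto_zero]
  refine squeeze_zero' (Eventually.of_forall fun _ => norm_nonneg _) hbound ?_
  have : Continuous fun x : E => 2 * (2 * C / (R / 2) * ‖x‖) / (R / 2) := by fun_prop
  simpa using this.tendsto 0

theorem HolMap.norm_lt_one {D : Set (Fin 3 → ℂ)} {f : (Fin 3 → ℂ) → ℂ} (hf : HolMap D unitDisc f)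
    {s : Fin 3 → ℂ} (hs : s ∈ D) : ‖f s‖ < 1 := by
  simpa [unitDisc] using hf.2 hs

theorem zero_mem_symmetrizedDisc : (0 : Fin 3 → ℂ) ∈ symmetrizedDisc 3 :=
  ball_subset_symmetrizedDisc (Metric.mem_ball_self (by norm_num))

open Metric Filter Topology Asymptotics in
theorem norm_fderiv_mul_norm_sub_le {f : (Fin 3 → ℂ) → ℂ} (hf : HolMap (symmetrizedDisc 3) unitDisc f)
    {a b c b' c' : ℂ} (h : ![a, b, c] ∈ symmetrizedDisc 3) (h' : ![a, b', c'] ∈ symmetrizedDisc 3) :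
    ‖b - b'‖ * ‖fderiv ℂ f 0 e₂‖ ≤ 2 := by
  have hstrict := hasStrictFDerivAt_of_differentiableOn_ball (R := 1 / 4) (C := 1) (by norm_num)
    (hf.1.mono ball_subset_symmetrizedDisc)
    (fun x hx => (hf.norm_lt_one (ball_subset_symmetrizedDisc hx)).le)
  set γ : ℂ → ℂ → ℂ → Fin 3 → ℂ := fun b c l => ![l * a, l ^ 2 * b, l ^ 3 * c] with hγ
  have γd : ∀ b c, Differentiable ℂ (γ b c) := fun b c => by
    rw [differentiable_pi]; intro i; fin_cases i <;> simp [hγ]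
  have γ0 : ∀ b c, γ b c 0 = 0 := fun b c => by ext i; fin_cases i <;> simp [hγ]
  have γm : ∀ b c, ![a, b, c] ∈ symmetrizedDisc 3 → ∀ l ∈ ball (0 : ℂ) 1,
      γ b c l ∈ symmetrizedDisc 3 := fun b c h l hl => by
    simpa [hγ] using weighted_smul_mem h (c := l) (by simpa using (mem_ball_zero_iff.1 hl).le)
  have hsubset : ∀ b c, ![a, b, c] ∈ symmetrizedDisc 3 →
      DifferentiableOn ℂ (fun l => f (γ b c l)) (ball 0 1) := fun b c h =>
    hf.1.comp (γd b c).differentiableOn (γm b c h)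
  set F : ℂ → ℂ := fun l => f (γ b c l) - f (γ b' c' l) with hF
  have hFd : DifferentiableOn ℂ F (ball 0 1) := (hsubset b c h).sub (hsubset b' c' h')
  have F0 : F 0 = 0 := by simp [hF, γ0]
  have hdiff : ∀ l, γ b c l - γ b' c' l = ![0, l ^ 2 * (b - b'), l ^ 3 * (c - c')] := fun l => by
    ext i; fin_cases i <;> simp [hγ] <;> ring
  have hO : (fun l => γ b c l - γ b' c' l) =O[𝓝 0] (fun l : ℂ => l ^ 2) := by
    simp only [hdiff]
    refine isBigO_pi.2 fun i => ?_
    fin_cases i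
    · simpa using isBigO_zero _ _
    · simpa [mul_comm] using (isBigO_refl (fun l : ℂ => l ^ 2) (𝓝 0)).const_mul_left (b - b')
    · have : (fun l : ℂ => l ^ 3) =O[𝓝 0] fun l : ℂ => l ^ 2 := (isLittleO_pow_pow (by norm_num)).isBigO
      simpa [mul_comm] using this.const_mul_left (c - c')
  have ho : (fun l => F l - fderiv ℂ f 0 (γ b c l - γ b' c' l)) =o[𝓝 0] (fun l : ℂ => l ^ 2) := by
    have ht : Tendsto (fun l => (γ b c l, γ b' c' l)) (𝓝 0) (𝓝 (0, 0)) := by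
      have : Continuous fun l => (γ b c l, γ b' c' l) :=
        (γd b c).continuous.prodMk (γd b' c').continuous
      simpa [γ0] using this.tendsto 0
    exact (hstrict.isLittleO.comp_tendsto ht).trans_isBigO hO
  set A : ℂ := (b - b') * fderiv ℂ f 0 e₂ with hA
  have hlin : (fun l => fderiv ℂ f 0 (γ b c l - γ b' c' l) - l ^ 2 * A) =o[𝓝 0]
      (fun l : ℂ => l ^ 2) := by
    have : (fun l => fderiv ℂ f 0 (γ b c l - γ b' c' l) - l ^ 2 * A) =
        fun l => (c - c') * fderiv ℂ f 0 (Pi.single 2 1) * l ^ 3 := by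
      ext l
      have e : ![0, l ^ 2 * (b - b'), l ^ 3 * (c - c')] =
        (l ^ 2 * (b - b')) • e₂ + (l ^ 3 * (c - c')) • (Pi.single 2 1 : Fin 3 → ℂ) := by
        ext i; fin_cases i <;> simp [e₂]
      rw [hdiff, e, map_add, map_smul, map_smul, hA]
      simp only [smul_eq_mul]; ring
    rw [this]
    exact (isLittleO_pow_pow (by norm_num)).const_mul_left _
  have hmain : (fun l => F l - l ^ 2 * A) =o[𝓝 0] (fun l : ℂ => l ^ 2) := by
    simpa using ho.add hlin
  have hF2 : ∀ l ∈ ball (0 : ℂ) 1, ‖F l‖ ≤ 2 * ‖l‖ ^ 2 := by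
    intro l hl
    -- F = o(l) at 0 corresponds to `n := 1`, and the Schwarz lemma then yields the exponent 2.
    have := Complex.dist_le_mul_div_pow_of_mapsTo_ball_of_isLittleO (n := 1) (R₂ := 2) hFd
      (fun w hw => ?_) ?_ hl
    · simpa [F0] using this
    · rw [F0, mem_closedBall_zero_iff]
      refine (norm_sub_le _ _).trans ?_
      linarith [hf.norm_lt_one (γm b c h w hw), hf.norm_lt_one (γm b' c' h' w hw)]
    · have h1 : (fun l : ℂ => l ^ 2) =o[𝓝 0] fun l : ℂ => l ^ 1 := isLittleO_pow_pow (by norm_num)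
      have h2 := (hmain.trans h1).add (h1.const_mul_left A)
      simpa [F0, mul_comm] using h2.norm_right
  have hev : ∀ᶠ l in 𝓝[≠] (0 : ℂ), ‖F l / l ^ 2‖ ≤ 2 := by
    filter_upwards [self_mem_nhdsWithin, mem_nhdsWithin_of_mem_nhds (ball_mem_nhds (0 : ℂ) one_pos)]
      with l hl hl1
    have : 0 < ‖l‖ := norm_pos_iff.2 hl
    rw [norm_div, norm_pow, div_le_iff₀ (by positivity)]
    exact hF2 l hl1
  have hlim : Tendsto (fun l => F l / l ^ 2) (𝓝[≠] 0) (𝓝 A) := by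
    have h1 := (hmain.mono nhdsWithin_le_nhds : _ =o[𝓝[≠] (0 : ℂ)] _).tendsto_div_nhds_zero
    have h2 := h1.add_const A
    rw [zero_add] at h2
    refine h2.congr' ?_
    filter_upwards [self_mem_nhdsWithin] with l hl
    have : l ≠ 0 := hl
    field_simp
    ring
  have := le_of_tendsto hlim.norm hev
  rwa [hA, norm_mul] at this

/-- The reflection w ↦ ζ conj w with ζ = s / conj s preserves the disc and fixes s. Applied to x, y,
z it gives a second point with the same first coordinate, and |s|² |e - ζ² conj e| = 2 |Im((conj s)²
e)|. -/
theorem norm_fderiv_mul_abs_im_le {f : (Fin 3 → ℂ) → ℂ} (hf : HolMap (symmetrizedDisc 3) unitDisc f)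
    {x y z s e : ℂ} (hx : ‖x‖ < 1) (hy : ‖y‖ < 1) (hz : ‖z‖ < 1) (hs : s = x + y + z)
    (he : e = x * y + x * z + y * z) :
    |(conj s ^ 2 * e).im| * ‖fderiv ℂ f 0 e₂‖ ≤ Complex.normSq s := by
  rcases eq_or_ne s 0 with h0 | h0
  · simp [h0]
  have hc0 : conj s ≠ 0 := by simpa using h0
  set ζ := s / conj s with hζ
  have hζ1 : ‖ζ‖ = 1 := by
    rw [hζ, norm_div, RCLike.norm_conj, div_self (norm_ne_zero_iff.2 h0)]
  have hn : ∀ w : ℂ, ‖w‖ < 1 → ‖ζ * conj w‖ < 1 := fun w hw => by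
    rwa [norm_mul, hζ1, RCLike.norm_conj, one_mul]
  have hζs : ζ * conj s = s := div_mul_cancel₀ _ hc0
  have h1 : ![s, e, x * y * z] ∈ symmetrizedDisc 3 :=
    mem_symmetrizedDisc_three.2 ⟨x, y, z, hx, hy, hz, by rw [hs, he]⟩
  have h2 : ![s, ζ ^ 2 * conj e, ζ ^ 3 * conj (x * y * z)] ∈ symmetrizedDisc 3 := by
    refine mem_symmetrizedDisc_three.2
      ⟨ζ * conj x, ζ * conj y, ζ * conj z, hn x hx, hn y hy, hn z hz, ?_⟩
    congr 1
    · conv_lhs => rw [← hζs, hs]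
      simp only [map_add]; ring
    · congr 1
      · rw [he]; simp only [map_add, map_mul]; ring
      · congr 1; simp only [map_mul]; ring
  have h3 := norm_fderiv_mul_norm_sub_le hf h1 h2
  have h4 : Complex.normSq s * ‖e - ζ ^ 2 * conj e‖ = 2 * |(conj s ^ 2 * e).im| := by
    have e1 : conj s ^ 2 * (e - ζ ^ 2 * conj e) =
        ((2 * (conj s ^ 2 * e).im : ℝ) : ℂ) * Complex.I := by
      rw [← Complex.sub_conj]
      simp only [map_mul, map_pow, Complex.conj_conj]
      linear_combination (-(ζ * conj s + s) * conj e) * hζs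
    have := congrArg norm e1
    rw [norm_mul, norm_mul, norm_pow, RCLike.norm_conj, Complex.norm_I, mul_one, Complex.norm_real,
      Real.norm_eq_abs, abs_mul, abs_two] at this
    rw [Complex.normSq_eq_norm_sq, this]
  have h5 := mul_le_mul_of_nonneg_left h3 (Complex.normSq_nonneg s)
  rw [← mul_assoc, h4] at h5
  linarith

theorem norm_fderiv_e₂_le {f : (Fin 3 → ℂ) → ℂ} (hf : HolMap (symmetrizedDisc 3) unitDisc f) :
    ‖fderiv ℂ f 0 e₂‖ ≤ 400 / 487 := by
  -- Rational approximation from inside of x = y = 1, |z| = 1, |s|² = √13 - 2, which maximizes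
  -- |Im((conj s)² e)| / |s|² on the curve x = y = 1; note 203² + 128² = 57593 < 240².
  set r : ℝ := 9999 / 10000 with hr
  set p : ℝ := -203 / 240 with hp
  set q : ℝ := 128 / 240 with hq
  have hrn : ‖(r : ℂ)‖ < 1 := by rw [Complex.norm_real, hr]; norm_num
  have hzn : ‖(⟨p, q⟩ : ℂ)‖ < 1 := by
    rw [← sq_lt_one_iff₀ (norm_nonneg _), ← Complex.normSq_eq_norm_sq, Complex.normSq_mk, hp, hq]
    norm_num
  have h := norm_fderiv_mul_abs_im_le hf (s := ⟨2 * r + p, q⟩)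
    (e := ⟨r ^ 2 + 2 * r * p, 2 * r * q⟩) hrn hrn hzn
    (by apply Complex.ext <;> simp; ring) (by apply Complex.ext <;> simp <;> ring)
  have him : (conj (⟨2 * r + p, q⟩ : ℂ) ^ 2 * (⟨r ^ 2 + 2 * r * p, 2 * r * q⟩ : ℂ)).im =
      ((2 * r + p) ^ 2 - q ^ 2) * (2 * r * q) - 2 * (2 * r + p) * q * (r ^ 2 + 2 * r * p) := by
    simp [pow_two]; ring
  rw [him, Complex.normSq_mk] at h
  have h5 := (mul_le_mul_of_nonneg_right (le_abs_self _) (norm_nonneg _)).trans h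
  rw [hr, hp, hq] at h5
  norm_num at h5
  linarith

theorem caratheodoryMetric_e₂_le :
    caratheodoryMetric (symmetrizedDisc 3) 0 e₂ ≤ 400 / 487 := by
  refine Real.sSup_le ?_ (by norm_num)
  rintro _ ⟨f, hf, -, rfl⟩
  exact norm_fderiv_e₂_le hf

/-! ### The lower bound for the second order Carathéodory metric -/

section DirectionalTaylor

variable {E : Type*} [NormedAddCommGroup E] [NormedSpace ℂ E]

open Metric Filter Topology in
theorem iteratedFDeriv_two_eq_deriv_deriv {f : E → ℂ} (X : E)
    (hf : ∀ᶠ x in 𝓝 (0 : E), DifferentiableAt ℂ f x) (hf' : DifferentiableAt ℂ (fderiv ℂ f) 0) :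
    iteratedFDeriv ℂ 2 f 0 (fun _ => X) = deriv (deriv fun t : ℂ => f (t • X)) 0 := by
  have hlin : ∀ t : ℂ, HasDerivAt (fun t : ℂ => t • X) X t := fun t => by
    simpa using (hasDerivAt_id t).smul_const X
  have ht : Tendsto (fun t : ℂ => t • X) (𝓝 0) (𝓝 0) := by
    simpa using (hlin 0).continuousAt.tendsto
  have h1 : deriv (fun t : ℂ => f (t • X)) =ᶠ[𝓝 0] fun t => fderiv ℂ f (t • X) X := by
    filter_upwards [ht.eventually hf] with t h
    exact (h.hasFDerivAt.comp_hasDerivAt t (hlin t)).deriv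
  rw [h1.deriv_eq, iteratedFDeriv_two_apply]
  have h2 : HasFDerivAt (fderiv ℂ f) (fderiv ℂ (fderiv ℂ f) 0) ((0 : ℂ) • X) := by
    simpa using hf'.hasFDerivAt
  have h3 := ((ContinuousLinearMap.apply ℂ ℂ X).hasFDerivAt.comp _ h2).comp_hasDerivAt (0 : ℂ) (hlin 0)
  exact h3.deriv.symm

open Metric Filter Topology in
-- Cauchy's estimate on the complex line through X. Boundedness is needed because the real `sSup` of
-- an unbounded set is 0.
theorem bddAbove_caratheodoryMetricOrder_two {D : Set E} (hD : D ∈ 𝓝 0) (X : E) :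
    BddAbove {r | ∃ f : E → ℂ, HolMap D unitDisc f ∧
      (∀ j < 2, iteratedFDeriv ℂ j f 0 = 0) ∧
        r = ‖taylorForm 2 f 0 X‖ ^ (1 / ((2 : ℕ) : ℝ))} := by
  obtain ⟨R, hR, hRD⟩ := Metric.mem_nhds_iff.1 hD
  set ρ := R / (‖X‖ + 1) with hρ
  have hX : 0 < ‖X‖ + 1 := by positivity
  have hρ0 : 0 < ρ := by positivity
  have hmem : ∀ t ∈ ball (0 : ℂ) ρ, t • X ∈ ball (0 : E) R := fun t ht => by
    rw [mem_ball_zero_iff] at *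
    rw [hρ, lt_div_iff₀ hX] at ht
    rw [norm_smul]
    nlinarith [norm_nonneg t]
  refine ⟨(1 / (ρ / 2) ^ 2) ^ (1 / ((2 : ℕ) : ℝ)), ?_⟩
  rintro _ ⟨f, hf, -, rfl⟩
  refine Real.rpow_le_rpow (norm_nonneg _) ?_ (by positivity)
  by_cases hf' : DifferentiableAt ℂ (fderiv ℂ f) 0
  · have hd : DifferentiableOn ℂ (fun t : ℂ => f (t • X)) (ball 0 ρ) :=
      (hf.1.mono hRD).comp (by fun_prop) hmem
    have hsub : closure (ball (0 : ℂ) (ρ / 2)) ⊆ ball 0 ρ :=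
      closure_ball_subset_closedBall.trans (closedBall_subset_ball (by linarith))
    have h1 := Complex.norm_iteratedDeriv_le_of_forall_mem_sphere_norm_le 2 (half_pos hρ0)
      (C := 1) (hd.mono hsub).diffContOnCl (fun t ht => by
        have := hf.2 (hRD (hmem t (sphere_subset_closedBall.trans
          (closedBall_subset_ball (by linarith)) ht)))
        exact (by simpa [unitDisc] using this : ‖f (t • X)‖ < 1).le)
    rw [iteratedDeriv_succ, iteratedDeriv_one] at h1
    rw [taylorForm, iteratedFDeriv_two_eq_deriv_deriv X ?_ hf', norm_mul]
    · simp only [Nat.factorial, norm_inv] at h1 ⊢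
      norm_num at h1 ⊢
      field_simp at h1 ⊢
      linarith
    · filter_upwards [ball_mem_nhds (0 : E) hR] with x hx
      exact (hf.1.mono hRD).differentiableAt (isOpen_ball.mem_nhds hx)
  -- Here the second derivative takes its default value 0.
  · rw [taylorForm, iteratedFDeriv_two_apply, fderiv_zero_of_not_differentiableAt hf']
    simp
    positivity

end DirectionalTaylor

theorem contDiff_quarticForm {n : WithTop ℕ∞} : ContDiff ℂ n quarticForm := by
  unfold quarticForm; fun_prop

theorem quarticForm_smul (X : Fin 3 → ℂ) (t : ℂ) :
    quarticForm (t • X) = X 1 ^ 2 * t ^ 2 - (431 / 1000 * X 0 ^ 2 * X 1) * t ^ 3 +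
      (121 / 2500 * X 0 ^ 4) * t ^ 4 := by
  simp [quarticForm]; ring

theorem deriv_quarticForm_smul (X : Fin 3 → ℂ) :
    deriv (fun t : ℂ => quarticForm (t • X)) = fun t => 2 * X 1 ^ 2 * t -
      3 * (431 / 1000 * X 0 ^ 2 * X 1) * t ^ 2 + 4 * (121 / 2500 * X 0 ^ 4) * t ^ 3 := by
  funext t
  simp only [quarticForm_smul]
  have h := (((hasDerivAt_pow 2 t).const_mul (X 1 ^ 2)).sub ((hasDerivAt_pow 3 t).const_mul
    (431 / 1000 * X 0 ^ 2 * X 1))).add ((hasDerivAt_pow 4 t).const_mul (121 / 2500 * X 0 ^ 4))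
  refine h.deriv.trans ?_
  norm_num
  ring

theorem deriv_deriv_quarticForm_smul (X : Fin 3 → ℂ) :
    deriv (deriv fun t : ℂ => quarticForm (t • X)) 0 = 2 * X 1 ^ 2 := by
  rw [deriv_quarticForm_smul]
  have h := (((hasDerivAt_id (0 : ℂ)).const_mul (2 * X 1 ^ 2)).sub
    ((hasDerivAt_pow 2 (0 : ℂ)).const_mul (3 * (431 / 1000 * X 0 ^ 2 * X 1)))).add
    ((hasDerivAt_pow 3 (0 : ℂ)).const_mul (4 * (121 / 2500 * X 0 ^ 4)))
  refine h.deriv.trans ?_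
  simp

theorem fderiv_quarticForm_zero : fderiv ℂ quarticForm 0 = 0 := by
  ext1 X
  have h : HasDerivAt (fun t : ℂ => t • X) X 0 := by
    simpa using (hasDerivAt_id (0 : ℂ)).smul_const X
  have hd : HasFDerivAt quarticForm (fderiv ℂ quarticForm 0) ((0 : ℂ) • X) := by
    simpa using ((contDiff_quarticForm (n := 1)).differentiable one_ne_zero 0).hasFDerivAt
  rw [← (hd.comp_hasDerivAt (0 : ℂ) h).deriv]
  change deriv (fun t : ℂ => quarticForm (t • X)) 0 = _
  rw [deriv_quarticForm_smul]
  simp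

/-- A multiple of the modulus of the second coordinate, as a seminorm. -/
noncomputable def coordSeminorm : Seminorm ℂ (Fin 3 → ℂ) :=
  (1027 / 1250 : NNReal) • (normSeminorm ℂ ℂ).comp (LinearMap.proj 1)

theorem coordSeminorm_apply (X : Fin 3 → ℂ) : coordSeminorm X = 1027 / 1250 * ‖X 1‖ := by
  simp [coordSeminorm, NNReal.smul_def]

theorem symmetrizedDisc_mem_nhds_zero : symmetrizedDisc 3 ∈ nhds 0 :=
  Filter.mem_of_superset (Metric.ball_mem_nhds 0 (by norm_num)) ball_subset_symmetrizedDisc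

/-- The competitor is (1027/1250)² P, admissible because (1027/1250)² · 37/25 < 1. -/
theorem coordSeminorm_le_caratheodoryMetricOrder (X : Fin 3 → ℂ) :
    coordSeminorm X ≤ caratheodoryMetricOrder 2 (symmetrizedDisc 3) 0 X := by
  set f : (Fin 3 → ℂ) → ℂ := fun s => (1027 / 1250) ^ 2 * quarticForm s with hf
  have hfC : ContDiff ℂ 2 f := contDiff_const.mul contDiff_quarticForm
  have hsecond : taylorForm 2 f 0 X = ((1027 / 1250) * X 1) ^ 2 := by
    have hdd : deriv (fun t : ℂ => f (t • X)) =
        fun t => (1027 / 1250) ^ 2 * deriv (fun t : ℂ => quarticForm (t • X)) t := by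
      funext t
      simp only [hf]
      exact deriv_const_mul_field _
    rw [taylorForm, iteratedFDeriv_two_eq_deriv_deriv X
      (Filter.Eventually.of_forall (hfC.differentiable two_ne_zero))
      ((hfC.fderiv_right (m := 1) (by norm_num)).differentiable one_ne_zero 0), hdd,
      deriv_const_mul_field, deriv_deriv_quarticForm_smul]
    norm_num
    ring
  refine le_csSup (bddAbove_caratheodoryMetricOrder_two symmetrizedDisc_mem_nhds_zero X)
    ⟨f, ⟨(hfC.differentiable two_ne_zero).differentiableOn, fun s hs => ?_⟩, fun j hj => ?_, ?_⟩
  · rw [unitDisc, mem_ball_zero_iff, hf, norm_mul]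
    have := norm_quarticForm_le hs
    norm_num
    linarith
  · interval_cases j
    · ext1 m
      simp [hf, quarticForm]
    · ext1 m
      rw [iteratedFDeriv_one_apply, hf, fderiv_const_mul
        ((contDiff_quarticForm (n := 1)).differentiable one_ne_zero 0), fderiv_quarticForm_zero]
      simp
  · rw [hsecond, norm_pow, Nat.cast_ofNat, ← Real.sqrt_eq_rpow, Real.sqrt_sq (norm_nonneg _),
      coordSeminorm_apply, norm_mul]
    norm_num

theorem caratheodoryMetric_lt_seminormHull_order :
    caratheodoryMetric (symmetrizedDisc 3) 0 e₂
      < seminormHull (caratheodoryMetricOrder 2 (symmetrizedDisc 3) 0) e₂ := by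
  have hnn : ∀ Y, 0 ≤ caratheodoryMetricOrder 2 (symmetrizedDisc 3) 0 Y := fun Y =>
    (apply_nonneg coordSeminorm Y).trans (coordSeminorm_le_caratheodoryMetricOrder Y)
  have h := (seminormHull_isGreatest hnn).2 coordSeminorm_le_caratheodoryMetricOrder e₂
  refine lt_of_le_of_lt caratheodoryMetric_e₂_le (lt_of_lt_of_le ?_ h)
  rw [coordSeminorm_apply]
  simp [e₂]
  norm_num

/-! ### Cauchy and Schwarz estimates in one variable -/

section OneVariable

open Metric Filter Topology Asymptotics

theorem norm_deriv_deriv_le {f : ℂ → ℂ} {C : ℝ} (hf : DifferentiableOn ℂ f (ball 0 1))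
    (hC : ∀ z ∈ ball (0 : ℂ) 1, ‖f z‖ ≤ C) : ‖deriv (deriv f) 0‖ ≤ 2 * C := by
  have h : ∀ r ∈ Set.Ioo (0 : ℝ) 1, ‖deriv (deriv f) 0‖ ≤ 2 * C / r ^ 2 := by
    rintro r ⟨h0, h1⟩
    have h2 := Complex.norm_iteratedDeriv_le_of_forall_mem_sphere_norm_le 2 h0 (C := C) (f := f)
      (hf.mono (closure_ball_subset_closedBall.trans (closedBall_subset_ball h1))).diffContOnCl
      (fun z hz => hC z (sphere_subset_closedBall.trans (closedBall_subset_ball h1) hz))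
    rw [iteratedDeriv_succ, iteratedDeriv_one] at h2
    simpa using h2
  have hlim : Tendsto (fun r : ℝ => 2 * C / r ^ 2) (𝓝[<] 1) (𝓝 (2 * C / 1 ^ 2)) := by
    refine Tendsto.mono_left (ContinuousAt.tendsto (f := fun r : ℝ => 2 * C / r ^ 2) ?_)
      nhdsWithin_le_nhds
    exact continuousAt_const.div (by fun_prop) (by norm_num)
  have := ge_of_tendsto hlim (eventually_of_mem (Ioo_mem_nhdsLT one_pos) h)
  simpa using this

theorem norm_deriv_le_of_ball_one {f : ℂ → ℂ} {C : ℝ} (hf : DifferentiableOn ℂ f (ball 0 1))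
    (hC : ∀ z ∈ ball (0 : ℂ) 1, ‖f z‖ ≤ C) : ‖deriv f 0‖ ≤ 2 * C := by
  refine (Complex.norm_deriv_le_div_of_mapsTo_ball (R₂ := 2 * C) hf (fun z hz => ?_)
    one_pos).trans_eq (div_one _)
  rw [mem_closedBall, dist_eq_norm]
  linarith [norm_sub_le (f z) (f 0), hC z hz, hC 0 (mem_ball_self one_pos)]

theorem norm_sub_sub_mul_deriv_le {f : ℂ → ℂ} {C : ℝ} (hf : DifferentiableOn ℂ f (ball 0 1))
    (hC : ∀ z ∈ ball (0 : ℂ) 1, ‖f z - f 0‖ ≤ C) {a : ℂ} (ha : a ∈ ball (0 : ℂ) 1) :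
    ‖f a - f 0 - a * deriv f 0‖ ≤ 2 * C * ‖a‖ ^ 2 := by
  have hd : ‖deriv f 0‖ ≤ C :=
    (Complex.norm_deriv_le_div_of_mapsTo_ball (R₂ := C) hf (fun z hz => by
      rw [mem_closedBall, dist_eq_norm]; exact hC z hz) one_pos).trans_eq (div_one _)
  have h := Complex.dist_le_mul_div_pow_of_mapsTo_ball_of_isLittleO (n := 1) (R₁ := 1)
    (R₂ := 2 * C) (c := (0 : ℂ)) (f := fun z => f z - z * deriv f 0) (z := a)
    (hf.sub (by fun_prop)) (fun z hz => ?_) ?_ ha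
  · rw [dist_eq_norm, dist_zero_right, div_one] at h
    have e : f a - f 0 - a * deriv f 0 = f a - a * deriv f 0 - (f 0 - 0 * deriv f 0) := by ring
    rw [e]
    exact h
  · rw [mem_closedBall, dist_eq_norm]
    have e : f z - z * deriv f 0 - (f 0 - 0 * deriv f 0) = f z - f 0 - z * deriv f 0 := by ring
    rw [e]
    refine (norm_sub_le _ _).trans ?_
    rw [norm_mul]
    have hz1 : ‖z‖ < 1 := by simpa using hz
    nlinarith [hC z hz, norm_nonneg z, norm_nonneg (deriv f 0)]
  · have h1 := ((hf.differentiableAt (ball_mem_nhds 0 one_pos)).hasDerivAt).isLittleO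
    refine (h1.norm_right.congr (fun z => ?_) (fun z => by simp))
    simp only [smul_eq_mul]; ring

end OneVariable

/-! ### Analytic discs and the Kobayashi metric -/

section Discs

open Metric Filter Topology

/-- The weighted homogeneous polynomial `Q` for which `quarticForm` is `Q ^ 2` plus a small
multiple of the fourth power of the first coordinate. -/
noncomputable def quadraticForm (s : Fin 3 → ℂ) : ℂ := s 1 - (431 / 2000) * s 0 ^ 2

theorem quarticForm_eq (s : Fin 3 → ℂ) :
    quarticForm s = quadraticForm s ^ 2 + 7839 / 4000000 * s 0 ^ 4 := by
  simp only [quarticForm, quadraticForm]; ring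

theorem norm_quadraticForm_le {s : Fin 3 → ℂ} (hs : ‖s‖ ≤ 3) :
    ‖quadraticForm s‖ ≤ 2 * ‖s‖ := by
  have h0 := norm_le_pi_norm s 0
  have h1 := norm_le_pi_norm s 1
  refine (norm_sub_le _ _).trans ?_
  rw [norm_mul, norm_pow]
  norm_num
  nlinarith [norm_nonneg (s 0)]

variable {φ : ℂ → Fin 3 → ℂ}

theorem HolMap.differentiableOn_apply (hφ : HolMap unitDisc (symmetrizedDisc 3) φ) (i : Fin 3) :
    DifferentiableOn ℂ (fun l => φ l i) (ball 0 1) :=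
  differentiableOn_pi.1 hφ.1 i

theorem HolMap.differentiableOn_quadraticForm (hφ : HolMap unitDisc (symmetrizedDisc 3) φ) :
    DifferentiableOn ℂ (fun l => quadraticForm (φ l)) (ball 0 1) :=
  (hφ.differentiableOn_apply 1).sub (((hφ.differentiableOn_apply 0).pow 2).const_mul _)

theorem HolMap.norm_quadraticForm_le_six (hφ : HolMap unitDisc (symmetrizedDisc 3) φ) {l : ℂ}
    (hl : l ∈ ball (0 : ℂ) 1) : ‖quadraticForm (φ l)‖ ≤ 6 := by
  have h := norm_le_of_mem_symmetrizedDisc (hφ.2 hl)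
  linarith [norm_quadraticForm_le h]

/-- With g = Q∘φ and h = φ₀, the function F = P∘φ is g² plus a multiple of h⁴. In F''(0)/2 every
term except g'(0)² has a factor g(0) or h(0), hence is O(‖φ(0)‖), and Cauchy's estimate gives
|F''(0)|/2 ≤ 37/25. The constant 100 is generous. -/
theorem sq_norm_deriv_quadraticForm_le (hφ : HolMap unitDisc (symmetrizedDisc 3) φ) :
    ‖deriv (fun l => quadraticForm (φ l)) 0‖ ^ 2 ≤ 37 / 25 + 100 * ‖φ 0‖ := by
  have h0 : (0 : ℂ) ∈ ball (0 : ℂ) 1 := mem_ball_self one_pos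
  set g : ℂ → ℂ := fun l => quadraticForm (φ l) with hg
  set h : ℂ → ℂ := fun l => φ l 0 with hh
  have gd : DifferentiableOn ℂ g (ball 0 1) := hφ.differentiableOn_quadraticForm
  have hd : DifferentiableOn ℂ h (ball 0 1) := hφ.differentiableOn_apply 0
  have hle : ∀ l ∈ ball (0 : ℂ) 1, ‖h l‖ ≤ 3 := fun l hl =>
    (norm_le_pi_norm (φ l) 0).trans (norm_le_of_mem_symmetrizedDisc (hφ.2 hl))
  have gle : ∀ l ∈ ball (0 : ℂ) 1, ‖g l‖ ≤ 6 := fun l hl => hφ.norm_quadraticForm_le_six hl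
  have hat : ∀ {f : ℂ → ℂ}, DifferentiableOn ℂ f (ball 0 1) → ∀ l ∈ ball (0 : ℂ) 1,
      HasDerivAt f (deriv f l) l := fun hf l hl =>
    (hf.differentiableAt (isOpen_ball.mem_nhds hl)).hasDerivAt
  set F : ℂ → ℂ := fun l => g l ^ 2 + 7839 / 4000000 * h l ^ 4 with hF
  have Fd : DifferentiableOn ℂ F (ball 0 1) := (gd.pow 2).add ((hd.pow 4).const_mul _)
  have Fle : ∀ l ∈ ball (0 : ℂ) 1, ‖F l‖ ≤ 37 / 25 := fun l hl => by
    have := norm_quarticForm_le (hφ.2 hl)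
    rwa [quarticForm_eq] at this
  have F1 : deriv F =ᶠ[𝓝 0] fun l =>
      2 * g l * deriv g l + 7839 / 4000000 * (4 * h l ^ 3 * deriv h l) := by
    filter_upwards [ball_mem_nhds (0 : ℂ) one_pos] with l hl
    have := ((hat gd l hl).pow 2).add (((hat hd l hl).pow 4).const_mul (7839 / 4000000))
    refine this.deriv.trans ?_
    norm_num
  have F2 : deriv (deriv F) 0 = 2 * (deriv g 0) ^ 2 + 2 * g 0 * deriv (deriv g) 0 +
      7839 / 4000000 * (12 * h 0 ^ 2 * deriv h 0 ^ 2 + 4 * h 0 ^ 3 * deriv (deriv h) 0) := by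
    rw [F1.deriv_eq]
    have g2 := hat (gd.deriv isOpen_ball) 0 h0
    have h2 := hat (hd.deriv isOpen_ball) 0 h0
    have := (((hat gd 0 h0).const_mul 2).mul g2).add
      (((((hat hd 0 h0).pow 3).const_mul 4).mul h2).const_mul (7839 / 4000000))
    refine this.deriv.trans ?_
    norm_num
    ring
  have b1 := norm_deriv_deriv_le Fd Fle
  have b2 := norm_deriv_deriv_le gd gle
  have b3 := norm_deriv_deriv_le hd hle
  have b4 := norm_deriv_le_of_ball_one hd hle
  set N := ‖φ 0‖ with hN
  have hN0 : 0 ≤ N := norm_nonneg _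
  have hN3 : N ≤ 3 := norm_le_of_mem_symmetrizedDisc (hφ.2 h0)
  have g0 : ‖g 0‖ ≤ 2 * N := norm_quadraticForm_le hN3
  have hh0 : ‖h 0‖ ≤ N := norm_le_pi_norm (φ 0) 0
  have e : (deriv g 0) ^ 2 = deriv (deriv F) 0 / 2 - (g 0 * deriv (deriv g) 0 +
      7839 / 4000000 * (6 * h 0 ^ 2 * deriv h 0 ^ 2 + 2 * h 0 ^ 3 * deriv (deriv h) 0)) := by
    rw [F2]; ring
  have t1 : ‖g 0 * deriv (deriv g) 0‖ ≤ (2 * N) * (2 * 6) := by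
    rw [norm_mul]; gcongr
  have t2 : ‖6 * h 0 ^ 2 * deriv h 0 ^ 2‖ ≤ 6 * N ^ 2 * (2 * 3) ^ 2 := by
    rw [norm_mul, norm_mul, norm_pow, norm_pow, Complex.norm_ofNat]; gcongr
  have t3 : ‖2 * h 0 ^ 3 * deriv (deriv h) 0‖ ≤ 2 * N ^ 3 * (2 * 3) := by
    rw [norm_mul, norm_mul, norm_pow, Complex.norm_ofNat]; gcongr
  have t4 : ‖(7839 / 4000000 : ℂ) * (6 * h 0 ^ 2 * deriv h 0 ^ 2 + 2 * h 0 ^ 3 * deriv (deriv h) 0)‖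
      ≤ 1 / 100 * (6 * N ^ 2 * (2 * 3) ^ 2 + 2 * N ^ 3 * (2 * 3)) := by
    rw [norm_mul]
    gcongr
    · norm_num
    · exact (norm_add_le _ _).trans (add_le_add t2 t3)
  rw [← norm_pow, e]
  refine (norm_sub_le _ _).trans ?_
  have t5 : ‖deriv (deriv F) 0 / 2‖ ≤ 37 / 25 := by
    rw [norm_div]; norm_num; linarith
  have t6 := (norm_add_le _ _).trans (add_le_add t1 t4)
  have n2 : N ^ 2 ≤ 3 * N := by nlinarith
  have n3 : N ^ 3 ≤ 9 * N := by nlinarith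
  linarith

theorem norm_deriv_quadraticForm_le (hφ : HolMap unitDisc (symmetrizedDisc 3) φ)
    (h0 : ‖φ 0‖ ≤ 1 / 100000) : ‖deriv (fun l => quadraticForm (φ l)) 0‖ ≤ 1250 / 1027 := by
  -- The slack in 1027/1250 absorbs the perturbation: 1.48 + 0.001 ≤ (1250/1027)² ≈ 1.4814.
  refine le_of_sq_le_sq ((sq_norm_deriv_quadraticForm_le hφ).trans ?_) (by norm_num)
  norm_num at h0 ⊢
  linarith

theorem norm_quadraticForm_sub_le (hφ : HolMap unitDisc (symmetrizedDisc 3) φ)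
    (h0 : ‖φ 0‖ ≤ 1 / 100000) {a : ℂ} (ha : ‖a‖ ≤ 1 / 1000000) :
    ‖quadraticForm (φ a) - quadraticForm (φ 0)‖ ≤ (1250 / 1027 + 1 / 10000) * ‖a‖ := by
  have ha1 : a ∈ ball (0 : ℂ) 1 := by
    rw [mem_ball_zero_iff]; exact ha.trans_lt (by norm_num)
  have h1 := norm_sub_sub_mul_deriv_le hφ.differentiableOn_quadraticForm (C := 12) (fun l hl => by
    refine (norm_sub_le _ _).trans ?_
    linarith [hφ.norm_quadraticForm_le_six hl, hφ.norm_quadraticForm_le_six (mem_ball_self one_pos)])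
    ha1
  have h2 := norm_deriv_quadraticForm_le hφ h0
  set d := deriv (fun l => quadraticForm (φ l)) 0
  have e : quadraticForm (φ a) - quadraticForm (φ 0) =
    (quadraticForm (φ a) - quadraticForm (φ 0) - a * d) + a * d := by ring
  rw [e]
  refine (norm_add_le _ _).trans ?_
  rw [norm_mul]
  nlinarith [norm_nonneg a, mul_le_mul_of_nonneg_left h2 (norm_nonneg a)]

theorem norm_sub_le_of_disc (hφ : HolMap unitDisc (symmetrizedDisc 3) φ) {a : ℂ}
    (ha : a ∈ unitDisc) : ‖φ a - φ 0‖ ≤ 6 * ‖a‖ := by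
  have h := Complex.dist_le_div_mul_dist_of_mapsTo_ball (R₂ := 6) hφ.1 (fun l hl => ?_) ha
  · simpa [dist_eq_norm] using h
  · rw [mem_closedBall, dist_eq_norm]
    refine (norm_sub_le _ _).trans ?_
    linarith [norm_le_of_mem_symmetrizedDisc (hφ.2 hl),
      norm_le_of_mem_symmetrizedDisc (hφ.2 (mem_ball_self one_pos))]

theorem HolMap.smul_disc {X : Fin 3 → ℂ} (hX : ‖X‖ ≤ 1 / 4) :
    HolMap unitDisc (symmetrizedDisc 3) (fun l => l • X) := by
  refine ⟨by fun_prop, fun l hl => ball_subset_symmetrizedDisc ?_⟩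
  have hl' : ‖l‖ < 1 := by simpa [unitDisc] using hl
  rw [mem_ball_zero_iff, norm_smul]
  nlinarith [norm_nonneg X, norm_nonneg l]

theorem coordSeminorm_le_kobayashiMetric (X : Fin 3 → ℂ) :
    coordSeminorm X ≤ kobayashiMetric (symmetrizedDisc 3) 0 X := by
  refine le_csInf ?_ ?_
  · have hX : (0 : ℝ) < 4 * (‖X‖ + 1) := by positivity
    have hle : ‖((4 * (‖X‖ + 1) : ℝ) : ℂ)⁻¹ • X‖ ≤ 1 / 4 := by
      rw [norm_smul, norm_inv, Complex.norm_real, Real.norm_of_nonneg hX.le]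
      field_simp
      linarith [norm_nonneg X]
    refine ⟨_, _, HolMap.smul_disc hle, by simp, ((4 * (‖X‖ + 1) : ℝ) : ℂ), ?_, rfl⟩
    have hd : HasDerivAt (fun l : ℂ => l • (((4 * (‖X‖ + 1) : ℝ) : ℂ)⁻¹ • X))
        (((4 * (‖X‖ + 1) : ℝ) : ℂ)⁻¹ • X) 0 := by
      simpa using (hasDerivAt_id (0 : ℂ)).smul_const (((4 * (‖X‖ + 1) : ℝ) : ℂ)⁻¹ • X)
    rw [hd.deriv, smul_smul, mul_inv_cancel₀ (by exact_mod_cast hX.ne'), one_smul]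
  · rintro _ ⟨φ, hφ, h0, α, rfl, rfl⟩
    have hb := norm_deriv_quadraticForm_le hφ (by rw [h0]; simp)
    have hd : HasDerivAt φ (deriv φ 0) 0 :=
      (hφ.1.differentiableAt (ball_mem_nhds 0 one_pos)).hasDerivAt
    have hi := hasDerivAt_pi.1 hd
    -- The square of the first coordinate contributes nothing, since φ vanishes at 0.
    have hq : deriv (fun l => quadraticForm (φ l)) 0 = deriv φ 0 1 := by
      refine ((hi 1).sub (((hi 0).pow 2).const_mul (431 / 2000))).deriv.trans ?_
      simp [h0]
    rw [hq] at hb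
    rw [coordSeminorm_apply, Pi.smul_apply, norm_smul]
    nlinarith [norm_nonneg α, mul_le_mul_of_nonneg_left hb (norm_nonneg α)]

theorem caratheodoryMetric_lt_seminormHull_kobayashi :
    caratheodoryMetric (symmetrizedDisc 3) 0 e₂
      < seminormHull (kobayashiMetric (symmetrizedDisc 3) 0) e₂ := by
  have hnn : ∀ Y, 0 ≤ kobayashiMetric (symmetrizedDisc 3) 0 Y := fun Y =>
    (apply_nonneg coordSeminorm Y).trans (coordSeminorm_le_kobayashiMetric Y)
  have h := (seminormHull_isGreatest hnn).2 coordSeminorm_le_kobayashiMetric e₂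
  refine lt_of_le_of_lt caratheodoryMetric_e₂_le (lt_of_lt_of_le ?_ h)
  rw [coordSeminorm_apply]
  simp [e₂]
  norm_num

end Discs

/-! ### From the metrics to the distances -/

theorem le_artanh {x : ℝ} (h0 : 0 ≤ x) (h1 : x < 1) : x ≤ Real.artanh x := by
  rw [Real.artanh_eq_half_log ⟨by linarith, h1.le⟩, Real.log_div (by linarith) (by linarith)]
  have h := le_hasSum (Real.hasSum_log_sub_log_of_abs_lt_one (abs_lt.2 ⟨by linarith, h1⟩)) 0
    (fun k _ => by positivity)
  norm_num at h
  linarith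

theorem artanh_le_div {x : ℝ} (h0 : 0 ≤ x) (h1 : x < 1) : Real.artanh x ≤ x / (1 - x) := by
  rw [Real.artanh_eq_half_log ⟨by linarith, h1.le⟩]
  have h2 : 0 < 1 - x := by linarith
  have h := Real.log_le_sub_one_of_pos (x := (1 + x) / (1 - x)) (by positivity)
  have e : (1 + x) / (1 - x) - 1 = 2 * (x / (1 - x)) := by field_simp; ring
  linarith

theorem HolMap.mobius {D : Set (Fin 3 → ℂ)} {f : (Fin 3 → ℂ) → ℂ} (hf : HolMap D unitDisc f)
    {a : ℂ} (ha : ‖a‖ < 1) :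
    HolMap D unitDisc (fun s => (a - f s) / (1 - conj a * f s)) := by
  have hlt : ∀ s ∈ D, ‖conj a * f s‖ < 1 := fun s hs => by
    rw [norm_mul, RCLike.norm_conj]
    nlinarith [hf.norm_lt_one hs, norm_nonneg a, norm_nonneg (f s)]
  have hne : ∀ s ∈ D, 1 - conj a * f s ≠ 0 := fun s hs h => by
    have := hlt s hs
    rw [← sub_eq_zero.1 h, norm_one] at this
    exact lt_irrefl _ this
  refine ⟨?_, fun s hs => ?_⟩
  · simp only [div_eq_mul_inv]
    exact (hf.1.const_sub a).mul (((hf.1.const_mul _).const_sub 1).inv hne)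
  rw [unitDisc, mem_ball_zero_iff, norm_div, div_lt_one (norm_pos_iff.2 (hne s hs)),
    ← sq_lt_sq₀ (norm_nonneg _) (norm_nonneg _), ← Complex.normSq_eq_norm_sq,
    ← Complex.normSq_eq_norm_sq, ← sub_pos]
  have e : Complex.normSq (1 - conj a * f s) - Complex.normSq (a - f s) =
      (1 - ‖a‖ ^ 2) * (1 - ‖f s‖ ^ 2) := by
    rw [← Complex.normSq_eq_norm_sq, ← Complex.normSq_eq_norm_sq]
    simp only [Complex.normSq_apply, Complex.sub_re, Complex.sub_im, Complex.mul_re, Complex.mul_im,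
      Complex.conj_re, Complex.conj_im, Complex.one_re, Complex.one_im]
    ring
  rw [e]
  have h2 := hf.norm_lt_one hs
  exact mul_pos (by nlinarith [norm_nonneg a]) (by nlinarith [norm_nonneg (f s)])

theorem norm_e₂ : ‖e₂‖ = 1 := by
  refine le_antisymm ((pi_norm_le_iff_of_nonneg zero_le_one).2 fun i => ?_) ?_
  · fin_cases i <;> simp [e₂]
  · simpa [e₂] using norm_le_pi_norm e₂ 1

theorem norm_quarter_smul_e₂ : ‖(1 / 4 : ℂ) • e₂‖ ≤ 1 / 4 := by
  rw [norm_smul, norm_e₂]; norm_num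

theorem norm_apply_smul_e₂_le {f : (Fin 3 → ℂ) → ℂ} (hf : HolMap (symmetrizedDisc 3) unitDisc f)
    (h0 : f 0 = 0) {t : ℝ} (ht : 0 ≤ t) (ht' : t < 1 / 4) :
    ‖f ((t : ℂ) • e₂)‖ ≤ 400 / 487 * t + 32 * t ^ 2 := by
  have hφ := HolMap.smul_disc norm_quarter_smul_e₂
  set ψ : ℂ → ℂ := fun l => f (l • (1 / 4 : ℂ) • e₂) with hψ
  have hψd : DifferentiableOn ℂ ψ (Metric.ball 0 1) := hf.1.comp hφ.1 hφ.2
  have hψ0 : ψ 0 = 0 := by simp [hψ, h0]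
  have hn : ‖((4 * t : ℝ) : ℂ)‖ = 4 * t := by rw [Complex.norm_real, Real.norm_of_nonneg]; positivity
  have h := norm_sub_sub_mul_deriv_le hψd (C := 1) (a := ((4 * t : ℝ) : ℂ)) (fun l hl => by
    rw [hψ0, sub_zero]; exact (hf.norm_lt_one (hφ.2 hl)).le)
    (by rw [mem_ball_zero_iff, hn]; linarith)
  have hd : deriv ψ 0 = 1 / 4 * fderiv ℂ f 0 e₂ := by
    have hl : HasDerivAt (fun l : ℂ => l • (1 / 4 : ℂ) • e₂) ((1 / 4 : ℂ) • e₂) 0 := by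
      simpa using (hasDerivAt_id (0 : ℂ)).smul_const ((1 / 4 : ℂ) • e₂)
    have hfd : HasFDerivAt f (fderiv ℂ f 0) ((0 : ℂ) • (1 / 4 : ℂ) • e₂) := by
      simpa using (hf.1.differentiableAt symmetrizedDisc_mem_nhds_zero).hasFDerivAt
    refine (hfd.comp_hasDerivAt (0 : ℂ) hl).deriv.trans ?_
    rw [map_smul, smul_eq_mul]
  have hψt : ψ ((4 * t : ℝ) : ℂ) = f ((t : ℂ) • e₂) := by
    simp only [hψ, smul_smul]; congr 2; push_cast; ring
  rw [hψt, hψ0, sub_zero, hn, hd] at h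
  have hB : ‖((4 * t : ℝ) : ℂ) * (1 / 4 * fderiv ℂ f 0 e₂)‖ ≤ 400 / 487 * t := by
    rw [norm_mul, norm_mul, hn]
    norm_num
    nlinarith [norm_fderiv_e₂_le hf]
  have e : f ((t : ℂ) • e₂) = (f ((t : ℂ) • e₂) - ((4 * t : ℝ) : ℂ) * (1 / 4 * fderiv ℂ f 0 e₂)) +
    ((4 * t : ℝ) : ℂ) * (1 / 4 * fderiv ℂ f 0 e₂) := by ring
  rw [e]
  refine (norm_add_le _ _).trans ?_
  linarith

theorem caratheodoryDist_smul_e₂_le {t : ℝ} (ht : 0 ≤ t) (ht' : t ≤ 1 / 10000000) :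
    caratheodoryDist (symmetrizedDisc 3) 0 ((t : ℂ) • e₂) ≤ 82145 / 100000 * t := by
  refine Real.sSup_le ?_ (by positivity)
  rintro _ ⟨f, hf, rfl⟩
  set a := f 0 with ha
  have ha1 : ‖a‖ < 1 := hf.norm_lt_one zero_mem_symmetrizedDisc
  -- Composing with the Möbius map that sends f(0) to 0 reduces to functions vanishing at 0, and
  -- turns the Poincaré distance into `artanh` of a modulus.
  have h := norm_apply_smul_e₂_le (hf.mobius ha1) (by simp [ha]) ht (by linarith)
  rw [poincareDist]
  set x := ‖(a - f ((t : ℂ) • e₂)) / (1 - conj a * f ((t : ℂ) • e₂))‖ with hx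
  have hx0 : 0 ≤ x := norm_nonneg _
  have hxt : x ≤ 82144 / 100000 * t := by nlinarith
  have hxs : x ≤ 1 / 10000000 := by linarith
  refine (artanh_le_div hx0 (by linarith)).trans ?_
  rw [div_le_iff₀ (by linarith)]
  nlinarith

/-- A short chain from 0 cannot leave a small ball: each disc moves a point by at most 6 r j. So the
disc estimate near 0 applies at every link, and the increments of `quadraticForm` add up. Both
bounds are carried through one induction. -/
theorem le_chain_length {m : ℕ} {p : ℕ → Fin 3 → ℂ} {r : ℕ → ℝ} (h0 : p 0 = 0)
    (hr : ∀ j < m, r j ∈ discRadii (symmetrizedDisc 3) (p j) (p (j + 1)))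
    (hL : ∑ j ∈ Finset.range m, r j ≤ 1 / 1000000) :
    ‖quadraticForm (p m)‖ ≤ (1250 / 1027 + 1 / 10000) * ∑ j ∈ Finset.range m, r j := by
  suffices H : ∀ k ≤ m, ‖p k‖ ≤ 6 * ∑ j ∈ Finset.range k, r j ∧
      ‖quadraticForm (p k)‖ ≤ (1250 / 1027 + 1 / 10000) * ∑ j ∈ Finset.range k, r j from
    (H m le_rfl).2
  have hnn : ∀ j < m, 0 ≤ r j := fun j hj => by
    obtain ⟨-, -, -, α, -, -, h⟩ := hr j hj
    rw [h]; exact norm_nonneg _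
  intro k
  induction k with
  | zero => intro _; simp [h0, quadraticForm]
  | succ k ih =>
    intro hk
    obtain ⟨ih1, ih2⟩ := ih (by omega)
    have hsum : ∑ j ∈ Finset.range (k + 1), r j ≤ 1 / 1000000 :=
      (Finset.sum_le_sum_of_subset_of_nonneg (Finset.range_mono hk)
        fun j hj _ => hnn j (Finset.mem_range.1 hj)).trans hL
    have hS : 0 ≤ ∑ j ∈ Finset.range k, r j :=
      Finset.sum_nonneg fun j hj => hnn j (by have := Finset.mem_range.1 hj; omega)
    have hrk := hnn k hk
    obtain ⟨φ, hφ, hφ0, α, hα, hφα, hrα⟩ := hr k hk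
    rw [Finset.sum_range_succ] at hsum ⊢
    have h1 := norm_sub_le_of_disc hφ hα
    have h2 := norm_quadraticForm_sub_le hφ (a := α) (by rw [hφ0]; linarith) (by linarith)
    rw [hφ0, hφα, ← hrα] at h1 h2
    have h3 := norm_le_norm_add_norm_sub' (p (k + 1)) (p k)
    have h4 := norm_le_norm_add_norm_sub' (quadraticForm (p (k + 1))) (quadraticForm (p k))
    constructor <;> linarith

theorem le_kobayashiDist_smul_e₂ {t : ℝ} (ht : 0 ≤ t) (ht' : t ≤ 1 / 10000000) :
    8215 / 10000 * t ≤ kobayashiDist (symmetrizedDisc 3) 0 ((t : ℂ) • e₂) := by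
  refine le_csInf ?_ ?_
  · refine ⟨_, 1, fun j => if j = 0 then 0 else (t : ℂ) • e₂, fun _ => ‖((4 * t : ℝ) : ℂ)‖,
      by simp, by simp, fun j hj => ?_, rfl⟩
    obtain rfl : j = 0 := by omega
    refine ⟨_, HolMap.smul_disc norm_quarter_smul_e₂, by simp, ((4 * t : ℝ) : ℂ), ?_, ?_, rfl⟩
    · rw [unitDisc, mem_ball_zero_iff, Complex.norm_real, Real.norm_of_nonneg (by positivity)]
      linarith
    · simp only [smul_smul]
      rw [if_neg (by omega)]
      congr 1; push_cast; ring
  · rintro _ ⟨m, p, r, h0, hm, hr, rfl⟩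
    have hle : ∑ j ∈ Finset.range m, r j ≤ ∑ j ∈ Finset.range m, Real.artanh (r j) := by
      refine Finset.sum_le_sum fun j hj => ?_
      obtain ⟨-, -, -, α, hα, -, h⟩ := hr j (Finset.mem_range.1 hj)
      rw [h]
      exact le_artanh (norm_nonneg _) (by simpa [unitDisc] using hα)
    refine le_trans ?_ hle
    -- A chain violating the bound is automatically shorter than 1/1000000, so `le_chain_length`
    -- applies; the contradiction is 0.8215 · (1250/1027 + 1/10000) < 1.
    by_contra! hlt
    have h := le_chain_length h0 hr (by linarith)
    have hq : ‖quadraticForm (p m)‖ = t := by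
      rw [hm]; simp [quadraticForm, e₂, abs_of_nonneg ht]
    rw [hq] at h
    linarith

theorem theoreme :
    caratheodoryMetric (symmetrizedDisc 3) 0 e₂
        < seminormHull (caratheodoryMetricOrder 2 (symmetrizedDisc 3) 0) e₂ ∧
      caratheodoryMetric (symmetrizedDisc 3) 0 e₂
        < seminormHull (kobayashiMetric (symmetrizedDisc 3) 0) e₂ ∧
      ∃ z ∈ symmetrizedDisc 3,
        kobayashiDist (symmetrizedDisc 3) 0 z ≠ caratheodoryDist (symmetrizedDisc 3) 0 z := by
  refine ⟨caratheodoryMetric_lt_seminormHull_order, caratheodoryMetric_lt_seminormHull_kobayashi,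
    ((1 / 10000000 : ℝ) : ℂ) • e₂, ball_subset_symmetrizedDisc ?_, ne_of_gt ?_⟩
  · rw [mem_ball_zero_iff, norm_smul, norm_e₂, Complex.norm_real]
    norm_num
  · have h1 := caratheodoryDist_smul_e₂_le (t := 1 / 10000000) (by norm_num) le_rfl
    have h2 := le_kobayashiDist_smul_e₂ (t := 1 / 10000000) (by norm_num) le_rfl
    linarith
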